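/- **Setup.** An extended binary tree is a finite rooted tree in which every node is either external (no children) or internal (one left and one right child); the external height $h(T)$ is the maximum depth of an external node of $T$ (so $h=0$ for the empty tree, whose only node is an external root). *Digital search tree.* Let $W_1,W_2,\dots$ be independent infinite strings of independent fair bits. $D_0$ is the empty tree. $D_n$ is obtained from $D_{n-1}$ by letting $W_n$ start at the root and move from each internal node of depth $d$ to its left or right child according as the $(d+1)$-th bit of $W_n$ is $0$ or $1$, until it reaches an external node; that node becomes internal and receives two external children. If instead the strings arrive at the points $\tau_1<\tau_2<\cdots$ of a Poisson process of rate $1$ on $[0,\infty)$ independent of the strings, and $N(t)=\#\{n\ge 1:\tau_n\le t\}$, then the continuous-time digital search tree is $\hat D_t:=D_{N(t)}$. *Border aggregation.* Let $K\ge 1$ and let $T_K$ be the complete binary tree of height $K$. Let $S_0$ be the set of its $2^K$ nodes of depth $K$. As long as the root is not in $S_{n-1}$, the $n$-th particle starts at the root and repeatedly moves to one of the two children of its current node, chosen with probability $\tfrac12$ each, all choices of all particles being independent, until it is at a node $v_n$ that is a neighbour of a node of $S_{n-1}$ (possibly the root itself); then $S_n:=S_{n-1}\cup\{v_n\}$.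 Let $\xi_K$ be the number of particles released until the root belongs to the sticky set. If the particles are released at the points of a Poisson process of rate $1$ on $[0,\infty)$ independent of the walks (which take no time), let $\Xi_K$ be the time at which the root becomes sticky. **Theorem.** (i) (Discrete time.) For all integers $K\ge1$ and $n\ge0$, $$\mathbb P(\xi_K\le n)=\mathbb P\bigl(h(D_n)\ge K\bigr).$$ (ii) (Continuous time.) For all integers $K\ge1$ and real $t\ge0$, $$\mathbb P(\Xi_K\le t)=\mathbb P\bigl(h(\hat D_t)\ge K\bigr).$$ -/

import Mathlib

open MeasureTheory ProbabilityTheory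

noncomputable section

namespace DST

/-! ### Extended binary trees

`BinaryTree α` is an extended binary tree: `nil` is an external node, `node x l r` is an
internal node storing `x`. Nodes are addressed by finite bit lists, read from the root
(`false` = left, `true` = right); the depth of a node is the length of its address. -/

/-- The external nodes of an extended binary tree. -/
def externalNodes {α : Type*} : BinaryTree α → Finset (List Bool)
  | .nil => {[]}
  | .node _ l r =>
      (externalNodes l).image (List.cons false) ∪ (externalNodes r).image (List.cons true)

/-- The external height: the maximum depth of an external node. -/
def externalHeight {α : Type*} (T : BinaryTree α) : ℕ :=
  (externalNodes T).sup List.length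

theorem externalNodes_nonempty {α : Type*} (T : BinaryTree α) : (externalNodes T).Nonempty := by
  induction T with
  | nil => simp [externalNodes]
  | node x l r hl hr => simp [externalNodes, hl]

/-- The external height agrees with Mathlib's recursively defined height. -/
theorem externalHeight_eq_height {α : Type*} (T : BinaryTree α) :
    externalHeight T = T.height := by
  have key : ∀ (b : Bool) (s : Finset (List Bool)), s.Nonempty →
      (s.image (List.cons b)).sup List.length = s.sup List.length + 1 := by
    intro b s hs
    rw [Finset.sup_image, ← Finset.sup'_eq_sup hs, ← Finset.sup'_eq_sup hs]
    exact (Finset.apply_sup'_eq_sup'_comp hs (fun n : ℕ => n + 1)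
      (fun x y => by simp [max_add_add_right])).symm
  induction T with
  | nil => simp [externalHeight, externalNodes]
  | node x l r hl hr =>
    simp only [externalHeight] at hl hr
    rw [externalHeight, externalNodes, Finset.sup_union, key _ _ (externalNodes_nonempty l),
      key _ _ (externalNodes_nonempty r), hl, hr, BinaryTree.height, max_add_add_right]

/-! ### Digital search trees -/

/-- Insert the item `w` into the subtree `T` whose root has depth `d` in the whole tree.
At an external node the item is stored; at an internal node of depth `d` it is passed to the
left or right child according to its `(d+1)`-th bit, which is `w d`. -/
def insertAt (w : ℕ → Bool) : ℕ → BinaryTree (ℕ → Bool) → BinaryTree (ℕ → Bool)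
  | _, .nil => .node w .nil .nil
  | d, .node x l r =>
      if w d then .node x l (insertAt w (d + 1) r) else .node x (insertAt w (d + 1) l) r

/-- The digital search tree built from the first `n` items of the sequence `W`; the items
are `W 0, W 1, …`. -/
def digitalSearchTree (W : ℕ → ℕ → Bool) : ℕ → BinaryTree (ℕ → Bool)
  | 0 => .nil
  | n + 1 => insertAt (W n) 0 (digitalSearchTree W n)

/-! ### The border aggregation model on the complete binary tree of height `K` -/

/-- The complete binary tree of height `K` as a graph: its vertices are the bit lists of length
at most `K` (longer lists are isolated), and each vertex is joined to its children. -/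
def completeTree (K : ℕ) : SimpleGraph (List Bool) :=
  SimpleGraph.fromRel fun u v => v.length ≤ K ∧ ∃ b : Bool, v = u ++ [b]

/-- Position after `j` steps of the directed walk from the root that takes its `(i+1)`-th step
to the left or right child according to the bit `w i`. -/
def walk (w : ℕ → Bool) (j : ℕ) : List Bool := (List.range j).map w

/-- The first node on the walk that is a neighbour of the sticky set `S`. -/
def stoppingNode (K : ℕ) (S : Set (List Bool)) (w : ℕ → Bool) : List Bool :=
  walk w (sInf {j : ℕ | ∃ s ∈ S, (completeTree K).Adj (walk w j) s})

open Classical in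
/-- The sticky set after `n` particles, where the particles perform the walks driven by
`U 0, U 1, …`. The process stops once the root is sticky. -/
def stickySet (K : ℕ) (U : ℕ → ℕ → Bool) : ℕ → Set (List Bool)
  | 0 => {v | v.length = K}
  | n + 1 =>
      if [] ∈ stickySet K U n then stickySet K U n
      else insert (stoppingNode K (stickySet K U n) (U n)) (stickySet K U n)

/-- The number of particles released until the root is sticky. (The set is never empty, as
each particle makes a new node of the finite tree sticky.) -/
def aggregationNumber (K : ℕ) (U : ℕ → ℕ → Bool) : ℕ :=
  sInf {n : ℕ | [] ∈ stickySet K U n}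

/-! ### Poissonization -/

/-- The `n`-th arrival time, for waiting times `η 0, η 1, …`; the `0`-th is `0`. -/
def arrivalTime (η : ℕ → ℝ) (n : ℕ) : ℝ := ∑ i ∈ Finset.range n, η i

/-- The number of arrivals up to time `t` (almost surely finite in the Poisson case). -/
def arrivalCount (η : ℕ → ℝ) (t : ℝ) : ℕ := {n : ℕ | 1 ≤ n ∧ arrivalTime η n ≤ t}.ncard

/-- The continuous-time digital search tree: built from the items arrived up to time `t`. -/
def continuousDigitalSearchTree (W : ℕ → ℕ → Bool) (η : ℕ → ℝ) (t : ℝ) :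
    BinaryTree (ℕ → Bool) :=
  digitalSearchTree W (arrivalCount η t)

/-- The time at which the root becomes sticky when the particles start at the arrival times. -/
def aggregationTime (K : ℕ) (U : ℕ → ℕ → Bool) (η : ℕ → ℝ) : ℝ :=
  sInf {t : ℝ | 0 ≤ t ∧ [] ∈ stickySet K U (arrivalCount η t)}

/-! ### The random input -/

/-- `W i ω` is the `i`-th random infinite bit string; all bits of all strings are independent
and each is `0` or `1` with probability `1/2`. -/
structure IsRandomBits {Ω : Type*} [MeasurableSpace Ω] (W : ℕ → Ω → ℕ → Bool)
    (μ : Measure Ω) : Prop where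
  measurable : ∀ i j, Measurable fun ω => W i ω j
  fair : ∀ i j, μ {ω | W i ω j = true} = 1 / 2
  indep : iIndepFun (fun (p : ℕ × ℕ) ω => W p.1 ω p.2) μ

/-- The `η i` are the waiting times of a Poisson process with rate `1`: independent and
exponentially distributed with rate `1`. -/
structure IsPoissonWaiting {Ω : Type*} [MeasurableSpace Ω] (η : ℕ → Ω → ℝ)
    (μ : Measure Ω) : Prop where
  measurable : ∀ i, Measurable (η i)
  law : ∀ i, μ.map (η i) = expMeasure 1
  indep : iIndepFun η μ

end DST

end

namespace DST

/-! ### A common recursion for both models -/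

/-! The two models are the same recursion run in opposite time directions. In a digital search tree
the first item takes the root whatever its bits, and the later items split by one bit into two
digital search trees. In border aggregation the two subtrees below the root evolve as separate
aggregations until the root is sticky; once a child of the root is sticky, the next particle makes
the root sticky whatever its bits. Hence the last particle plays the role of the first item, and for
a fixed list of strings both events become `Reaches`, with the list reversed for aggregation
(`le_height_insertAll_iff`, `nil_mem_aggregate_iff`).

Reversing the first `n` i.i.d. strings preserves their joint law, which gives (i). For (ii), split
by the number of arrivals up to `t`: it is independent of the strings and has the same law in both
models, so (i) applies to each term. -/

/-- The items of `l` whose bit at depth `d` is `b`. -/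
def branch (d : ℕ) (b : Bool) (l : List (ℕ → Bool)) : List (ℕ → Bool) :=
  l.filter fun w => w d == b

/-- `Reaches d K l`: feeding the items `l`, one after the other, to a digital search tree rooted
at depth `d` yields a tree of height at least `K`. Equivalently, `l` makes the root of the
complete binary tree of height `K` sticky when its items are released from last to first. -/
def Reaches : ℕ → ℕ → List (ℕ → Bool) → Prop
  | _, 0, _ => True
  | _, _ + 1, [] => False
  | d, K + 1, _ :: l => Reaches (d + 1) K (branch d false l) ∨ Reaches (d + 1) K (branch d true l)

theorem reaches_succ_cons {d K : ℕ} {u : ℕ → Bool} {l : List (ℕ → Bool)} :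
    Reaches d (K + 1) (u :: l) ↔ ∃ b, Reaches (d + 1) K (branch d b l) := by
  simp [Reaches]

theorem branch_cons_self (d : ℕ) (u : ℕ → Bool) (l : List (ℕ → Bool)) :
    branch d (u d) (u :: l) = u :: branch d (u d) l := by
  simp [branch]

theorem branch_cons_of_ne {d : ℕ} {b : Bool} {u : ℕ → Bool} (h : u d ≠ b)
    (l : List (ℕ → Bool)) : branch d b (u :: l) = branch d b l := by
  simp [branch, h]

/-- Only the presence of a head matters, not its bits, so it suffices to compare the tails, even
when the two heads differ. -/
theorem Reaches.mono {d K : ℕ} {l l' : List (ℕ → Bool)} (hl : l.Sublist l')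
    (h : Reaches d K l) : Reaches d K l' := by
  induction K generalizing d l l' with
  | zero => trivial
  | succ K ih =>
    cases l with
    | nil => exact h.elim
    | cons u l =>
      cases l' with
      | nil => simp at hl
      | cons u' l' =>
        obtain ⟨b, hb⟩ := reaches_succ_cons.1 h
        exact reaches_succ_cons.2 ⟨b, ih (hl.tail.filter _) hb⟩

theorem length_branch_add_length_branch (d : ℕ) (l : List (ℕ → Bool)) :
    (branch d false l).length + (branch d true l).length = l.length := by
  induction l with
  | nil => rfl
  | cons u l ih =>
    simp only [branch, beq_true, beq_false, List.filter_cons] at ih ⊢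
    cases u d <;> simp <;> omega

/-- Pigeonhole: after the head, at least `2 ^ (K + 1) - 1` items remain, so one branch receives `2 ^
K` of them. This guarantees that the root eventually becomes sticky. -/
theorem reaches_of_two_pow_le_length {d K : ℕ} {l : List (ℕ → Bool)} (h : 2 ^ K ≤ l.length) :
    Reaches d K l := by
  induction K generalizing d l with
  | zero => trivial
  | succ K ih =>
    cases l with
    | nil => simp at h
    | cons u l =>
      have hlen := length_branch_add_length_branch d l
      rw [pow_succ, List.length_cons] at h
      by_cases hf : 2 ^ K ≤ (branch d false l).length
      · exact Or.inl (ih hf)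
      · exact Or.inr (ih (by omega))

/-- `Reaches d K` only depends on the bits at the depths below `d + K`. -/
theorem reaches_map_iff {d K : ℕ} {f : (ℕ → Bool) → ℕ → Bool}
    (hf : ∀ w, ∀ i < d + K, f w i = w i) (l : List (ℕ → Bool)) :
    Reaches d K (l.map f) ↔ Reaches d K l := by
  induction K generalizing d l with
  | zero => simp [Reaches]
  | succ K ih =>
    cases l with
    | nil => simp [Reaches]
    | cons u l =>
      rw [List.map_cons, reaches_succ_cons, reaches_succ_cons]
      refine exists_congr fun b => ?_
      have hb : branch d b (l.map f) = (branch d b l).map f := by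
        simp only [branch, List.filter_map]
        congr 2
        funext w
        simp [hf w d (by omega)]
      rw [hb]
      exact ih (fun w i hi => hf w i (by omega)) _

/-! ### Digital search trees -/

/-- Insert the items of a list, one after the other, into a tree rooted at depth `d`. -/
def insertAll (d : ℕ) (T : BinaryTree (ℕ → Bool)) (l : List (ℕ → Bool)) :
    BinaryTree (ℕ → Bool) :=
  l.foldl (fun T w => insertAt w d T) T

theorem insertAll_node (d : ℕ) (x : ℕ → Bool) (L R : BinaryTree (ℕ → Bool))
    (l : List (ℕ → Bool)) :
    insertAll d (.node x L R) l =
      .node x (insertAll (d + 1) L (branch d false l)) (insertAll (d + 1) R (branch d true l)) := by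
  induction l generalizing L R with
  | nil => rfl
  | cons u l ih =>
    simp only [insertAll, branch] at ih
    cases hu : u d <;> simp [insertAll, branch, insertAt, hu, ih]

theorem le_height_insertAll_iff {d K : ℕ} {l : List (ℕ → Bool)} :
    K ≤ (insertAll d .nil l).height ↔ Reaches d K l := by
  induction K generalizing d l with
  | zero => simp [Reaches]
  | succ K ih =>
    cases l with
    | nil => simp [insertAll, Reaches]
    | cons u l =>
      have h : insertAll d .nil (u :: l) = insertAll d (.node u .nil .nil) l := rfl
      rw [h, insertAll_node, BinaryTree.height, Nat.add_le_add_iff_right, le_max_iff, ih, ih]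
      rfl

theorem digitalSearchTree_eq_insertAll (W : ℕ → ℕ → Bool) (n : ℕ) :
    digitalSearchTree W n = insertAll 0 .nil ((List.range n).map W) := by
  induction n with
  | zero => rfl
  | succ n ih => simp [digitalSearchTree, ih, List.range_succ, insertAll]

theorem le_externalHeight_digitalSearchTree_iff {W : ℕ → ℕ → Bool} {K n : ℕ} :
    K ≤ externalHeight (digitalSearchTree W n) ↔ Reaches 0 K ((List.range n).map W) := by
  rw [externalHeight_eq_height, digitalSearchTree_eq_insertAll, le_height_insertAll_iff]

/-! ### Border aggregation -/

theorem completeTree_adj {K : ℕ} {u v : List Bool} :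
    (completeTree K).Adj u v ↔
      (v.length ≤ K ∧ ∃ b : Bool, v = u ++ [b]) ∨ (u.length ≤ K ∧ ∃ b : Bool, u = v ++ [b]) := by
  rw [completeTree, SimpleGraph.fromRel_adj, and_iff_right_iff_imp]
  rintro (⟨-, b, rfl⟩ | ⟨-, b, rfl⟩) <;> simp

theorem completeTree_adj_nil {K : ℕ} {v : List Bool} :
    (completeTree (K + 1)).Adj [] v ↔ ∃ b : Bool, v = [b] := by
  rw [completeTree_adj]
  constructor
  · rintro (⟨-, b, rfl⟩ | ⟨-, b, h⟩)
    · exact ⟨b, rfl⟩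
    · simp at h
  · rintro ⟨b, rfl⟩
    exact Or.inl ⟨by simp, b, rfl⟩

theorem completeTree_adj_cons_cons {K : ℕ} {b c : Bool} {u v : List Bool} :
    (completeTree (K + 1)).Adj (b :: u) (c :: v) ↔ b = c ∧ (completeTree K).Adj u v := by
  simp only [completeTree_adj, List.length_cons, Nat.add_le_add_iff_right, List.cons_append,
    List.cons.injEq]
  grind

theorem walk_succ (w : ℕ → Bool) (j : ℕ) :
    walk w (j + 1) = w 0 :: walk (fun i => w (i + 1)) j := by
  simp [walk, List.range_succ_eq_map, Function.comp_def]

theorem stoppingNode_eq_nil {K : ℕ} {S : Set (List Bool)} {b : Bool} (hb : [b] ∈ S)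
    (w : ℕ → Bool) : stoppingNode (K + 1) S w = [] := by
  have h : sInf {j : ℕ | ∃ s ∈ S, (completeTree (K + 1)).Adj (walk w j) s} = 0 :=
    Nat.sInf_eq_zero.2 (Or.inl ⟨[b], hb, completeTree_adj_nil.2 ⟨b, rfl⟩⟩)
  rw [stoppingNode, h]
  rfl

/-- Unless a particle stops at the root, it continues as a particle in one of the two subtrees
below the root. -/
theorem stoppingNode_eq_cons {K : ℕ} {S : Set (List Bool)} (hS : {v | v.length = K + 1} ⊆ S)
    (hnil : [] ∉ S) (hchild : ∀ b, [b] ∉ S) (w : ℕ → Bool) :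
    stoppingNode (K + 1) S w =
      w 0 :: stoppingNode K {v | w 0 :: v ∈ S} (fun i => w (i + 1)) := by
  set J : Set ℕ := {j : ℕ | ∃ s ∈ S, (completeTree (K + 1)).Adj (walk w j) s} with hJ
  have h0 : 0 ∉ J := by
    rintro ⟨s, hs, hadj⟩
    obtain ⟨b, rfl⟩ := completeTree_adj_nil.1 hadj
    exact hchild b hs
  have hne : J.Nonempty := by
    -- At depth `K` the next node of the walk is a leaf, which is sticky.
    refine ⟨K, walk w (K + 1), hS (by simp [walk]), completeTree_adj.2 (Or.inl ⟨?_, w K, ?_⟩)⟩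
    · simp [walk]
    · simp [walk, List.range_succ]
  have hpos : 1 ≤ sInf J := by
    rw [Nat.one_le_iff_ne_zero]
    intro h
    exact h0 (h ▸ Nat.sInf_mem hne)
  have hsucc : {j : ℕ | ∃ s ∈ {v | w 0 :: v ∈ S},
      (completeTree K).Adj (walk (fun i => w (i + 1)) j) s} = {j | j + 1 ∈ J} := by
    ext j
    simp only [hJ, Set.mem_ofPred_eq, walk_succ]
    constructor
    · rintro ⟨s, hs, hadj⟩
      exact ⟨_, hs, completeTree_adj_cons_cons.2 ⟨rfl, hadj⟩⟩
    · rintro ⟨s, hs, hadj⟩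
      cases s with
      | nil => exact absurd hs hnil
      | cons c v =>
        obtain ⟨rfl, hadj'⟩ := completeTree_adj_cons_cons.1 hadj
        exact ⟨v, hs, hadj'⟩
  have key : sInf {j | j + 1 ∈ J} + 1 = sInf J := Nat.sInf_add hpos
  rw [stoppingNode, stoppingNode, hsucc, ← walk_succ, key]

open Classical in
/-- The sticky set of the complete binary tree of height `K` after the particles of a list have
been released from last to first, where the particle `u` follows the bits `u d, u (d + 1), …`. -/
def aggregate (d K : ℕ) : List (ℕ → Bool) → Set (List Bool)
  | [] => {v | v.length = K}
  | u :: l =>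
      if [] ∈ aggregate d K l then aggregate d K l
      else insert (stoppingNode K (aggregate d K l) fun i => u (d + i)) (aggregate d K l)

theorem aggregate_subset_cons (d K : ℕ) (u : ℕ → Bool) (l : List (ℕ → Bool)) :
    aggregate d K l ⊆ aggregate d K (u :: l) := by
  rw [aggregate]
  split_ifs
  · exact subset_rfl
  · exact Set.subset_insert _ _

theorem leaves_subset_aggregate (d K : ℕ) (l : List (ℕ → Bool)) :
    {v | v.length = K} ⊆ aggregate d K l := by
  induction l with
  | nil => exact subset_rfl
  | cons u l ih => exact ih.trans (aggregate_subset_cons d K u l)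

theorem aggregate_cons_of_notMem {d K : ℕ} {l : List (ℕ → Bool)} (h : [] ∉ aggregate d K l)
    (u : ℕ → Bool) :
    aggregate d K (u :: l) =
      insert (stoppingNode K (aggregate d K l) fun i => u (d + i)) (aggregate d K l) := by
  rw [aggregate, if_neg h]

/-- As long as the root is not sticky, the sticky sets of the two subtrees below it evolve as
aggregation processes driven by the particles that enter them. -/
theorem setOf_cons_mem_aggregate_eq {d K : ℕ} {l : List (ℕ → Bool)}
    (h : [] ∉ aggregate d (K + 1) l) (b : Bool) :
    {v | b :: v ∈ aggregate d (K + 1) l} = aggregate (d + 1) K (branch d b l) := by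
  induction l generalizing b with
  | nil => simp [aggregate, branch]
  | cons u l ih =>
    have hl : [] ∉ aggregate d (K + 1) l := fun hl => h (aggregate_subset_cons _ _ _ _ hl)
    rw [aggregate_cons_of_notMem hl] at h ⊢
    have hchild : ∀ c, [c] ∉ aggregate d (K + 1) l := fun c hc =>
      h (Set.mem_insert_iff.2 (Or.inl (stoppingNode_eq_nil hc _).symm))
    rw [stoppingNode_eq_cons (leaves_subset_aggregate _ _ _) hl hchild, add_zero, ih hl]
    simp only [← add_assoc, add_right_comm d _ 1]
    by_cases hb : u d = b
    · subst hb
      -- The child that `u` enters is not yet sticky, so the aggregation below it is still running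
      -- and accepts `u`.
      have hroot : [] ∉ aggregate (d + 1) K (branch d (u d) l) := by
        rw [← ih hl]
        exact hchild _
      rw [branch_cons_self, aggregate_cons_of_notMem hroot, ← ih hl]
      ext v
      simp
    · rw [branch_cons_of_ne hb, ← ih hl b]
      ext v
      simp [Ne.symm hb]

theorem nil_mem_aggregate_cons_iff {d K : ℕ} {u : ℕ → Bool} {l : List (ℕ → Bool)}
    (h : [] ∉ aggregate d (K + 1) l) :
    [] ∈ aggregate d (K + 1) (u :: l) ↔ ∃ b, [b] ∈ aggregate d (K + 1) l := by
  rw [aggregate_cons_of_notMem h, Set.mem_insert_iff, or_iff_left h]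
  constructor
  · intro hnil
    by_contra! hchild
    rw [stoppingNode_eq_cons (leaves_subset_aggregate _ _ _) h hchild] at hnil
    simp at hnil
  · rintro ⟨b, hb⟩
    exact (stoppingNode_eq_nil hb _).symm

/-- The head is the last particle released. If the root is not sticky before it, it stops there
exactly when some child is sticky, a question about the tail in a subtree of height `K`. If the root
is already sticky, monotonicity of `Reaches` absorbs the extra particle. -/
theorem nil_mem_aggregate_iff {d K : ℕ} {l : List (ℕ → Bool)} :
    [] ∈ aggregate d K l ↔ Reaches d K l := by
  induction K generalizing d l with
  | zero => simpa [Reaches] using leaves_subset_aggregate d 0 l (by simp)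
  | succ K ihK =>
    induction l with
    | nil => simp [aggregate, Reaches]
    | cons u l ihl =>
      by_cases hl : [] ∈ aggregate d (K + 1) l
      · exact iff_of_true (aggregate_subset_cons _ _ _ _ hl)
          ((ihl.1 hl).mono (List.sublist_cons_self u l))
      · rw [nil_mem_aggregate_cons_iff hl, reaches_succ_cons]
        refine exists_congr fun b => ?_
        rw [← ihK, ← setOf_cons_mem_aggregate_eq hl, Set.mem_ofPred_eq]

theorem stickySet_eq_aggregate (K : ℕ) (U : ℕ → ℕ → Bool) (n : ℕ) :
    stickySet K U n = aggregate 0 K ((List.range n).map U).reverse := by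
  induction n with
  | zero => rfl
  | succ n ih =>
    have hl : ((List.range (n + 1)).map U).reverse = U n :: ((List.range n).map U).reverse := by
      simp [List.range_succ]
    rw [stickySet, hl, aggregate]
    simp only [← ih, zero_add]
    -- The two sides may differ only in their decidability instances.
    congr

theorem nil_mem_stickySet_iff {K : ℕ} {U : ℕ → ℕ → Bool} {n : ℕ} :
    [] ∈ stickySet K U n ↔ Reaches 0 K ((List.range n).map U).reverse := by
  rw [stickySet_eq_aggregate, nil_mem_aggregate_iff]

/-- The root stays sticky once it is, and `2 ^ K` particles suffice, so the infimum is attained. -/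
theorem nil_mem_stickySet_iff_aggregationNumber_le {K : ℕ} {U : ℕ → ℕ → Bool} {n : ℕ} :
    [] ∈ stickySet K U n ↔ aggregationNumber K U ≤ n := by
  have hmono : ∀ {m n}, m ≤ n → [] ∈ stickySet K U m → [] ∈ stickySet K U n := by
    intro m n hmn
    rw [nil_mem_stickySet_iff, nil_mem_stickySet_iff]
    exact Reaches.mono ((List.range_sublist.2 hmn).map U).reverse
  have hne : {n | [] ∈ stickySet K U n}.Nonempty :=
    ⟨2 ^ K, nil_mem_stickySet_iff.2 (reaches_of_two_pow_le_length (by simp))⟩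
  exact ⟨fun h => Nat.sInf_le h, fun h => hmono h (Nat.sInf_mem hne)⟩

open Filter Topology

/-! ### The law of finitely many random bits -/

section Bits

variable {Ω Ω' : Type*} [MeasurableSpace Ω] [MeasurableSpace Ω'] {μ : Measure Ω}
  {μ' : Measure Ω'} {W : ℕ → Ω → ℕ → Bool} {U : ℕ → Ω' → ℕ → Bool}

/-- The first `K` bits of the strings with the indices `σ 0, …, σ (n - 1)`. -/
def selectBits {n : ℕ} (σ : Fin n → ℕ) (K : ℕ) (w : ℕ → ℕ → Bool) : Fin n × Fin K → Bool :=
  fun p => w (σ p.1) p.2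

theorem measurable_selectBits {n : ℕ} (σ : Fin n → ℕ) (K : ℕ) : Measurable (selectBits σ K) := by
  unfold selectBits
  fun_prop

theorem IsRandomBits.measurable_strings (hW : IsRandomBits W μ) :
    Measurable fun ω i => W i ω :=
  measurable_pi_iff.2 fun i => measurable_pi_iff.2 fun j => hW.measurable i j

variable [IsProbabilityMeasure μ] [IsProbabilityMeasure μ']

theorem IsRandomBits.map_bit_eq (hW : IsRandomBits W μ) (hU : IsRandomBits U μ')
    (i j k l : ℕ) : μ.map (fun ω => W i ω j) = μ'.map (fun ω => U k ω l) := by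
  have := Measure.isProbabilityMeasure_map (hW.measurable i j).aemeasurable (μ := μ)
  have := Measure.isProbabilityMeasure_map (hU.measurable k l).aemeasurable (μ := μ')
  have htrue : μ.map (fun ω => W i ω j) {true} = μ'.map (fun ω => U k ω l) {true} := by
    rw [Measure.map_apply (hW.measurable i j) (measurableSet_singleton _),
      Measure.map_apply (hU.measurable k l) (measurableSet_singleton _)]
    exact (hW.fair i j).trans (hU.fair k l).symm
  refine Measure.ext_of_singleton fun b => ?_
  cases b
  · have hc : ({false} : Set Bool) = {true}ᶜ := by ext b; cases b <;> simp
    rw [hc, prob_compl_eq_one_sub (measurableSet_singleton _),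
      prob_compl_eq_one_sub (measurableSet_singleton _), htrue]
  · exact htrue

/-- Injectivity of the selections makes the chosen bits distinct, so both laws are the same product
of fair coins. -/
theorem IsRandomBits.map_selectBits_eq (hW : IsRandomBits W μ) (hU : IsRandomBits U μ')
    {n : ℕ} {σ τ : Fin n → ℕ} (hσ : σ.Injective) (hτ : τ.Injective) (K : ℕ) :
    μ.map (fun ω => selectBits σ K fun i => W i ω) =
      μ'.map (fun ω => selectBits τ K fun i => U i ω) := by
  have hinj : ∀ {ρ : Fin n → ℕ}, ρ.Injective →
      Function.Injective fun p : Fin n × Fin K => (ρ p.1, (p.2 : ℕ)) :=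
    fun hρ => hρ.prodMap Fin.val_injective
  have h1 := (iIndepFun_iff_map_fun_eq_pi_map
    (fun p : Fin n × Fin K => (hW.measurable (σ p.1) p.2).aemeasurable)).1
    (hW.indep.precomp (hinj hσ))
  have h2 := (iIndepFun_iff_map_fun_eq_pi_map
    (fun p : Fin n × Fin K => (hU.measurable (τ p.1) p.2).aemeasurable)).1
    (hU.indep.precomp (hinj hτ))
  refine h1.trans (Eq.trans ?_ h2.symm)
  congr 1
  funext p
  exact hW.map_bit_eq hU _ _ _ _

/-- The event depends on finitely many bits, through a set `Q` that is the same for every selection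
`σ`. This gives measurability and lets the direct and reversed orders be compared. -/
theorem exists_preimage_selectBits_eq (n K : ℕ) :
    ∃ Q : Set (Fin n × Fin K → Bool), ∀ σ : Fin n → ℕ,
      {w : ℕ → ℕ → Bool | Reaches 0 K (List.ofFn fun i => w (σ i))} = selectBits σ K ⁻¹' Q := by
  -- Bits from depth `K` on are irrelevant and are padded with `false`.
  refine ⟨{x | Reaches 0 K (List.ofFn fun i j => if h : j < K then x (i, ⟨j, h⟩) else false)},
    fun σ => Set.ext fun w => ?_⟩
  have h := reaches_map_iff (d := 0) (K := K)
    (f := fun (w : ℕ → Bool) j => if j < K then w j else false) (by simp +contextual)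
    (List.ofFn fun i => w (σ i))
  rw [List.map_ofFn] at h
  simpa [selectBits, Function.comp_def] using h.symm

theorem measurableSet_reaches {n : ℕ} (K : ℕ) (σ : Fin n → ℕ) :
    MeasurableSet {w : ℕ → ℕ → Bool | Reaches 0 K (List.ofFn fun i => w (σ i))} := by
  obtain ⟨Q, hQ⟩ := exists_preimage_selectBits_eq n K
  rw [hQ σ]
  exact measurable_selectBits σ K (.of_discrete)

theorem IsRandomBits.measure_reaches_eq (hW : IsRandomBits W μ) (hU : IsRandomBits U μ')
    {n : ℕ} {σ τ : Fin n → ℕ} (hσ : σ.Injective) (hτ : τ.Injective) (K : ℕ) :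
    μ {ω | Reaches 0 K (List.ofFn fun i => W (σ i) ω)} =
      μ' {ω | Reaches 0 K (List.ofFn fun i => U (τ i) ω)} := by
  obtain ⟨Q, hQ⟩ := exists_preimage_selectBits_eq n K
  have h := congrArg (fun ν => ν Q) (hW.map_selectBits_eq hU hσ hτ K)
  have hW' : Measurable fun ω => selectBits σ K fun i => W i ω :=
    (measurable_selectBits σ K).comp hW.measurable_strings
  have hU' : Measurable fun ω => selectBits τ K fun i => U i ω :=
    (measurable_selectBits τ K).comp hU.measurable_strings
  simp only [Measure.map_apply hW' (MeasurableSet.of_discrete (s := Q)),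
    Measure.map_apply hU' (MeasurableSet.of_discrete (s := Q))] at h
  have hσQ : (fun ω i => W i ω) ⁻¹' (selectBits σ K ⁻¹' Q) =
      {ω | Reaches 0 K (List.ofFn fun i => W (σ i) ω)} := by rw [← hQ σ]; rfl
  have hτQ : (fun ω i => U i ω) ⁻¹' (selectBits τ K ⁻¹' Q) =
      {ω | Reaches 0 K (List.ofFn fun i => U (τ i) ω)} := by rw [← hQ τ]; rfl
  rw [← hσQ, ← hτQ]
  exact h

end Bits

theorem map_range_eq_ofFn {α : Type*} (f : ℕ → α) (n : ℕ) :
    (List.range n).map f = List.ofFn fun i : Fin n => f i :=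
  List.ext_getElem (by simp) (by simp)

theorem reverse_map_range_eq_ofFn {α : Type*} (f : ℕ → α) (n : ℕ) :
    ((List.range n).map f).reverse = List.ofFn fun i : Fin n => f i.rev := by
  refine List.ext_getElem (by simp) fun i hi _ => ?_
  simp only [List.getElem_reverse, List.getElem_map, List.getElem_range, List.getElem_ofFn,
    Fin.val_rev, List.length_map, List.length_range]
  congr 1
  omega

theorem setOf_le_externalHeight_eq (K n : ℕ) :
    {w | K ≤ externalHeight (digitalSearchTree w n)} =
      {w : ℕ → ℕ → Bool | Reaches 0 K (List.ofFn fun i : Fin n => w i)} := by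
  ext w
  simp only [Set.mem_ofPred_eq, le_externalHeight_digitalSearchTree_iff, map_range_eq_ofFn]

theorem setOf_nil_mem_stickySet_eq (K n : ℕ) :
    {u | [] ∈ stickySet K u n} =
      {u : ℕ → ℕ → Bool | Reaches 0 K (List.ofFn fun i : Fin n => u i.rev)} := by
  ext u
  simp only [Set.mem_ofPred_eq, nil_mem_stickySet_iff, reverse_map_range_eq_ofFn]

/-- Reversing the order of the first `n` strings turns aggregation into digital search. -/
theorem IsRandomBits.measure_nil_mem_stickySet_eq
    {Ω Ω' : Type*} [MeasurableSpace Ω] [MeasurableSpace Ω'] {μ : Measure Ω}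
    [IsProbabilityMeasure μ] {μ' : Measure Ω'} [IsProbabilityMeasure μ'] {W : ℕ → Ω → ℕ → Bool}
    {U : ℕ → Ω' → ℕ → Bool} (hW : IsRandomBits W μ) (hU : IsRandomBits U μ') (K n : ℕ) :
    μ' {ω | [] ∈ stickySet K (fun i => U i ω) n} =
      μ {ω | K ≤ externalHeight (digitalSearchTree (fun i => W i ω) n)} := by
  have h := hU.measure_reaches_eq hW (σ := fun i : Fin n => (i.rev : ℕ)) (τ := Fin.val)
    (Fin.val_injective.comp Fin.rev_injective) Fin.val_injective K
  simp only [nil_mem_stickySet_iff, reverse_map_range_eq_ofFn,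
    le_externalHeight_digitalSearchTree_iff]
  simpa only [map_range_eq_ofFn] using h

/-! ### Arrival times -/

section Arrival

variable {η : ℕ → ℝ} {t : ℝ}

theorem arrivalTime_mono (hη : ∀ i, 0 ≤ η i) : Monotone (arrivalTime η) :=
  monotone_nat_of_le_succ fun n => by
    rw [arrivalTime, arrivalTime, Finset.sum_range_succ]
    linarith [hη n]

/-- Divergence makes the counted set finite, so `ncard` does not take its default value `0`. The set
is the interval from `1` up to, but excluding, the first index whose arrival exceeds `t`. -/
theorem le_arrivalCount_iff (hη : ∀ i, 0 ≤ η i) (hη' : Tendsto (arrivalTime η) atTop atTop)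
    (ht : 0 ≤ t) {m : ℕ} : m ≤ arrivalCount η t ↔ arrivalTime η m ≤ t := by
  classical
  have hex : ∃ n, t < arrivalTime η n := (hη'.eventually_gt_atTop t).exists
  have hle : ∀ n, arrivalTime η n ≤ t ↔ n < Nat.find hex := fun n => by
    refine ⟨fun h => ?_, fun h => not_lt.1 (Nat.find_min hex h)⟩
    by_contra! hn
    exact absurd h (not_le.2 ((Nat.find_spec hex).trans_le (arrivalTime_mono hη hn)))
  have hpos : 0 < Nat.find hex := (hle 0).1 (by simpa [arrivalTime] using ht)
  have hset : {n : ℕ | 1 ≤ n ∧ arrivalTime η n ≤ t} = ↑(Finset.Ico 1 (Nat.find hex)) := by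
    ext n
    simp only [Set.mem_ofPred_eq, Finset.coe_Ico, Set.mem_Ico, hle]
  rw [arrivalCount, hset, Set.ncard_coe_finset, Nat.card_Ico, hle]
  omega

/-- The waiting times for which exactly `n` arrivals occur up to time `t`. -/
def exactArrivals (t : ℝ) (n : ℕ) : Set (ℕ → ℝ) :=
  {η | (∀ i, 0 ≤ η i) ∧ arrivalTime η n ≤ t ∧ t < arrivalTime η (n + 1)}

theorem measurableSet_exactArrivals (t : ℝ) (n : ℕ) : MeasurableSet (exactArrivals t n) := by
  have hm : ∀ n, Measurable fun η : ℕ → ℝ => arrivalTime η n := fun n => by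
    unfold arrivalTime
    fun_prop
  have h0 : MeasurableSet {η : ℕ → ℝ | ∀ i, 0 ≤ η i} := by
    rw [Set.ofPred_forall]
    exact .iInter fun i => measurableSet_le measurable_const (measurable_pi_apply i)
  exact h0.inter ((measurableSet_le (hm n) measurable_const).inter
    (measurableSet_lt measurable_const (hm (n + 1))))

theorem pairwise_disjoint_exactArrivals (t : ℝ) :
    Pairwise (Function.onFun Disjoint (exactArrivals t)) := by
  rw [pairwise_disjoint_on]
  intro m n hmn
  rw [Set.disjoint_left]
  rintro η ⟨hη, -, h1⟩ ⟨-, h2, -⟩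
  exact absurd (arrivalTime_mono hη hmn) (not_le.2 (h2.trans_lt h1))

theorem mem_exactArrivals_iff (hη : ∀ i, 0 ≤ η i) (hη' : Tendsto (arrivalTime η) atTop atTop)
    (ht : 0 ≤ t) {n : ℕ} : η ∈ exactArrivals t n ↔ arrivalCount η t = n := by
  have h1 := le_arrivalCount_iff hη hη' ht (m := n)
  have h2 := le_arrivalCount_iff hη hη' ht (m := n + 1)
  rw [exactArrivals, Set.mem_ofPred_eq, and_iff_right hη, ← not_le, ← h1, ← h2]
  omega

theorem aggregationTime_le_iff (hη : ∀ i, 0 ≤ η i)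
    (hη' : Tendsto (arrivalTime η) atTop atTop) (ht : 0 ≤ t) (K : ℕ) (U : ℕ → ℕ → Bool) :
    aggregationTime K U η ≤ t ↔ [] ∈ stickySet K U (arrivalCount η t) := by
  -- The root turns sticky exactly at the arrival of particle number `aggregationNumber K U`.
  have hset : {s : ℝ | 0 ≤ s ∧ [] ∈ stickySet K U (arrivalCount η s)} =
      Set.Ici (arrivalTime η (aggregationNumber K U)) := by
    ext s
    rw [Set.mem_ofPred_eq, Set.mem_Ici, nil_mem_stickySet_iff_aggregationNumber_le]
    constructor
    · rintro ⟨hs, h⟩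
      exact (le_arrivalCount_iff hη hη' hs).1 h
    · intro h
      have hs : 0 ≤ s := (Finset.sum_nonneg fun i _ => hη i).trans h
      exact ⟨hs, (le_arrivalCount_iff hη hη' hs).2 h⟩
  rw [aggregationTime, hset, csInf_Ici, nil_mem_stickySet_iff_aggregationNumber_le,
    le_arrivalCount_iff hη hη' ht]

end Arrival

/-! ### Poissonization -/

section Poisson

variable {Ω : Type*} [MeasurableSpace Ω] {μ : Measure Ω} {η : ℕ → Ω → ℝ}

theorem IsPoissonWaiting.measure_le (hη : IsPoissonWaiting η μ) (i : ℕ) {x : ℝ} (hx : 0 ≤ x) :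
    μ {ω | η i ω ≤ x} = ENNReal.ofReal (1 - Real.exp (-x)) := by
  have := isProbabilityMeasure_expMeasure one_pos
  have h : μ.map (η i) (Set.Iic x) = μ {ω | η i ω ≤ x} :=
    Measure.map_apply (hη.measurable i) measurableSet_Iic
  rw [← h, hη.law, ← ofReal_cdf, cdf_expMeasure_eq one_pos, if_pos hx, one_mul]

theorem IsPoissonWaiting.ae_nonneg (hη : IsPoissonWaiting η μ) :
    ∀ᵐ ω ∂μ, ∀ i, 0 ≤ η i ω := by
  refine ae_all_iff.2 fun i => ?_
  have h : μ {ω | η i ω ≤ 0} = 0 := by simp [hη.measure_le i le_rfl]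
  exact measure_mono_null (fun ω (hω : ¬ 0 ≤ η i ω) => (not_le.1 hω).le) h

variable [IsProbabilityMeasure μ]

/-- Second Borel–Cantelli lemma: the events are independent, each of probability `exp (-1)`. -/
theorem IsPoissonWaiting.ae_frequently_one_lt (hη : IsPoissonWaiting η μ) :
    ∀ᵐ ω ∂μ, ∃ᶠ i in atTop, 1 < η i ω := by
  have hmeas : ∀ i, MeasurableSet (η i ⁻¹' Set.Ioi 1) := fun i => hη.measurable i measurableSet_Ioi
  have hindep : iIndepSet (fun i => η i ⁻¹' Set.Ioi 1) μ :=
    (iIndepSet_iff_meas_biInter hmeas).2 fun s =>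
      hη.indep.measure_inter_preimage_eq_mul s fun _ _ => measurableSet_Ioi
  have hprob : ∀ i, μ (η i ⁻¹' Set.Ioi 1) = ENNReal.ofReal (Real.exp (-1)) := fun i => by
    have hc : η i ⁻¹' Set.Ioi 1 = {ω | η i ω ≤ 1}ᶜ := by
      ext ω
      simp
    rw [hc, prob_compl_eq_one_sub (measurableSet_le (hη.measurable i) measurable_const),
      hη.measure_le i zero_le_one, ← ENNReal.ofReal_one,
      ← ENNReal.ofReal_sub _ (by simp), sub_sub_cancel]
  have hsum : ∑' i, μ (η i ⁻¹' Set.Ioi 1) = ⊤ := by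
    simp only [hprob]
    exact ENNReal.tsum_const_eq_top_of_ne_zero (by simp [Real.exp_pos])
  have hone := measure_limsup_eq_one hmeas hindep hsum
  rw [← prob_compl_eq_zero_iff (.measurableSet_limsup hmeas)] at hone
  refine measure_mono_null (fun ω hω => ?_) hone
  rwa [Set.mem_compl_iff, mem_limsup_iff_frequently_mem]

theorem IsPoissonWaiting.ae_tendsto_arrivalTime (hη : IsPoissonWaiting η μ) :
    ∀ᵐ ω ∂μ, Tendsto (arrivalTime fun i => η i ω) atTop atTop := by
  filter_upwards [hη.ae_nonneg, hη.ae_frequently_one_lt] with ω h0 h1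
  rcases tendsto_atTop_of_monotone (arrivalTime_mono h0) with h | ⟨l, hl⟩
  · exact h
  -- If the arrival times converged, their increments would tend to `0`, yet infinitely many exceed
  -- `1`.
  · have hz : Tendsto (fun i => η i ω) atTop (𝓝 0) := by
      have := ((tendsto_add_atTop_iff_nat 1).2 hl).sub hl
      simpa [arrivalTime, Finset.sum_range_succ] using this
    exact absurd (hz.eventually_lt_const one_pos) fun h =>
      h1 (h.mono fun i hi => not_lt.2 hi.le)

/-- The law of a random index `arrivalCount` independent of `X` splits the probability of an
event that depends on both. -/
theorem IsPoissonWaiting.measure_mem_arrivalCount {α : Type*} [MeasurableSpace α]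
    {X : Ω → α} (hX : Measurable X) (hη : IsPoissonWaiting η μ)
    (hind : IndepFun X (fun ω i => η i ω) μ) {A : ℕ → Set α} (hA : ∀ n, MeasurableSet (A n))
    {t : ℝ} (ht : 0 ≤ t) :
    μ {ω | X ω ∈ A (arrivalCount (fun i => η i ω) t)} =
      ∑' n, μ (X ⁻¹' A n) * Measure.infinitePi (fun _ : ℕ => expMeasure 1) (exactArrivals t n) := by
  have hYm : Measurable fun ω i => η i ω := measurable_pi_iff.2 hη.measurable
  -- The weights are thus expressed without `μ`, so they agree for the two models.
  have hlaw : μ.map (fun ω i => η i ω) = Measure.infinitePi (fun _ : ℕ => expMeasure 1) := by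
    rw [hη.indep.map_fun_eq_infinitePi_map hη.measurable]
    simp only [hη.law]
  have hae : {ω | X ω ∈ A (arrivalCount (fun i => η i ω) t)} =ᵐ[μ]
      ⋃ n, X ⁻¹' A n ∩ (fun ω i => η i ω) ⁻¹' exactArrivals t n := by
    refine eventuallyEq_set.2 ?_
    filter_upwards [hη.ae_nonneg, hη.ae_tendsto_arrivalTime] with ω h0 h1
    simp [mem_exactArrivals_iff h0 h1 ht]
  rw [measure_congr hae, measure_iUnion]
  · refine tsum_congr fun n => ?_
    rw [hind.measure_inter_preimage_eq_mul _ _ (hA n) (measurableSet_exactArrivals t n), ← hlaw,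
      Measure.map_apply hYm (measurableSet_exactArrivals t n)]
  · intro m n hmn
    exact ((pairwise_disjoint_exactArrivals t hmn).preimage _).mono Set.inter_subset_right
      Set.inter_subset_right
  · exact fun n => (hX (hA n)).inter (hYm (measurableSet_exactArrivals t n))

end Poisson

end DST

theorem theorem1p1
    {Ω Ω' : Type*} [MeasurableSpace Ω] [MeasurableSpace Ω']
    (μ : Measure Ω) [IsProbabilityMeasure μ] (μ' : Measure Ω') [IsProbabilityMeasure μ']
    (W : ℕ → Ω → ℕ → Bool) (hW : DST.IsRandomBits W μ)
    (U : ℕ → Ω' → ℕ → Bool) (hU : DST.IsRandomBits U μ') :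
    (∀ K : ℕ, 1 ≤ K → ∀ n : ℕ,
      μ' {ω | DST.aggregationNumber K (fun i => U i ω) ≤ n} =
        μ {ω | K ≤ DST.externalHeight (DST.digitalSearchTree (fun i => W i ω) n)}) ∧
    (∀ (η : ℕ → Ω → ℝ) (η' : ℕ → Ω' → ℝ),
      DST.IsPoissonWaiting η μ → IndepFun (fun ω i => W i ω) (fun ω i => η i ω) μ →
      DST.IsPoissonWaiting η' μ' → IndepFun (fun ω i => U i ω) (fun ω i => η' i ω) μ' →
      ∀ K : ℕ, 1 ≤ K → ∀ t : ℝ, 0 ≤ t →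
        μ' {ω | DST.aggregationTime K (fun i => U i ω) (fun i => η' i ω) ≤ t} =
          μ {ω | K ≤ DST.externalHeight
            (DST.continuousDigitalSearchTree (fun i => W i ω) (fun i => η i ω) t)}) := by
  refine ⟨fun K _ n => ?_, fun η η' hη hWη hη' hUη' K _ t ht => ?_⟩
  · simpa only [DST.nil_mem_stickySet_iff_aggregationNumber_le] using
      hW.measure_nil_mem_stickySet_eq hU K n
  · have hU_meas : ∀ n, MeasurableSet {u | [] ∈ DST.stickySet K u n} := fun n => by
      rw [DST.setOf_nil_mem_stickySet_eq]
      exact DST.measurableSet_reaches K fun i : Fin n => (i.rev : ℕ)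
    have hW_meas : ∀ n, MeasurableSet {w | K ≤ DST.externalHeight (DST.digitalSearchTree w n)} :=
      fun n => by
        rw [DST.setOf_le_externalHeight_eq]
        exact DST.measurableSet_reaches K fun i : Fin n => (i : ℕ)
    have hae : {ω | DST.aggregationTime K (fun i => U i ω) (fun i => η' i ω) ≤ t} =ᵐ[μ']
        {ω | (fun i => U i ω) ∈
          {u | [] ∈ DST.stickySet K u (DST.arrivalCount (fun i => η' i ω) t)}} := by
      refine Filter.eventuallyEq_set.2 ?_
      filter_upwards [hη'.ae_nonneg, hη'.ae_tendsto_arrivalTime] with ω h0 h1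
      exact DST.aggregationTime_le_iff h0 h1 ht K _
    rw [measure_congr hae,
      hη'.measure_mem_arrivalCount hU.measurable_strings hUη' hU_meas ht]
    refine Eq.trans ?_
      (hη.measure_mem_arrivalCount hW.measurable_strings hWη hW_meas ht).symm
    exact tsum_congr fun n => congrArg (· * _) (hW.measure_nil_mem_stickySet_eq hU K n)
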